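/- Let $G$ be a finite graph without loops (parallel edges are allowed). Let $D(G)$ be the set of vertices of $G$ that are exposed (left uncovered) by at least one maximum matching of $G$, and let $A(G)$ be the set of vertices outside $D(G)$ that are adjacent to a vertex in $D(G)$. An edge of $G$ is allowed if some maximum matching of $G$ contains it. A factor-component of $G$ is a subgraph of the form $G[V(C)]$, where $C$ is a connected component of the spanning subgraph of $G$ whose edges are the allowed edges; it is consistent if it is disjoint from $D(G)$, and inconsistent otherwise. Theorem. A subgraph $H$ of $G$ is an inconsistent factor-component of $G$ if and only if it is the subgraph of $G$ induced by the vertex set of a connected component of $G[D(G)\cup A(G)]\setminus E(G[A(G)])$, the graph obtained from $G[D(G)\cup A(G)]$ by deleting all edges with both ends in $A(G)$; that is, $H=G[V(K)]$ for some connected component $K$ of $G[D(G)\cup A(G)]\setminus E(G[A(G)])$. -/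

import Mathlib

open scoped Graph

namespace Graph

variable {α β : Type*}

/-- A set `M` of edges of `G` is a matching if no two distinct members share an end. -/
def IsMatching (G : Graph α β) (M : Set β) : Prop :=
  M ⊆ E(G) ∧ ∀ e ∈ M, ∀ f ∈ M, ∀ x, G.Inc e x → G.Inc f x → e = f

/-- A maximum matching: a matching of greatest cardinality. -/
def IsMaximumMatching (G : Graph α β) (M : Set β) : Prop :=
  G.IsMatching M ∧ ∀ N, G.IsMatching N → N.encard ≤ M.encard

/-- `M` exposes the vertex `v` if no edge of `M` is incident with `v`. -/
def Exposes (G : Graph α β) (M : Set β) (v : α) : Prop :=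
  v ∈ V(G) ∧ ∀ e ∈ M, ¬ G.Inc e v

/-- `Γ_G(X)`: the vertices outside `X` joined to some vertex of `X`. -/
def neighbors (G : Graph α β) (X : Set α) : Set α :=
  {v | v ∈ V(G) ∧ v ∉ X ∧ ∃ x ∈ X, G.Adj x v}

/-- `D(G)`: the vertices exposed by some maximum matching. -/
def gallaiD (G : Graph α β) : Set α :=
  {v | ∃ M, G.IsMaximumMatching M ∧ G.Exposes M v}

/-- `A(G)`: the neighbors of `D(G)`. -/
def gallaiA (G : Graph α β) : Set α :=
  G.neighbors G.gallaiD

/-- The allowed edges: those lying in some maximum matching. -/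
def allowedEdges (G : Graph α β) : Set β :=
  {e | ∃ M, G.IsMaximumMatching M ∧ e ∈ M}

/-- A graph is connected if it has a vertex and any two of its vertices are joined by a walk. -/
def IsConnected (G : Graph α β) : Prop :=
  V(G).Nonempty ∧ ∀ x ∈ V(G), ∀ y ∈ V(G), Relation.ReflTransGen G.Adj x y

/-- `K` is a connected component of `G`: a maximal connected subgraph. -/
def IsConnectedComponent (K G : Graph α β) : Prop :=
  Maximal (fun L : Graph α β ↦ L ≤ G ∧ L.IsConnected) K

/-- `H` is a factor-component of `G`: the subgraph of `G` induced by the vertex set of a connected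
component of the spanning subgraph of `G` whose edges are the allowed edges. -/
def IsFactorComponent (H G : Graph α β) : Prop :=
  ∃ C : Graph α β, C.IsConnectedComponent (G.restrict G.allowedEdges) ∧ H = G.induce V(C)

/-- A factor-component is consistent if it is disjoint from `D(G)`. -/
def IsConsistentFactorComponent (H G : Graph α β) : Prop :=
  H.IsFactorComponent G ∧ Disjoint V(H) G.gallaiD

/-- A factor-component is inconsistent if it is not consistent. -/
def IsInconsistentFactorComponent (H G : Graph α β) : Prop :=
  H.IsFactorComponent G ∧ ¬ H.IsConsistentFactorComponent G

end Graph

namespace Graph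

variable {α β : Type*} {G K : Graph α β} {M N : Set β} {e f g : β} {u v w x y : α}

/-! ### Matchings -/

/-! Two facts carry the proof. Every edge at `D(G)` is allowed: a maximum matching exposing one end
covers the other, and exchanging edges there puts the edge in. Every allowed edge at `A(G)` ends in
`D(G)` (`mem_gallaiD_of_mem_gallaiA`, resting on `IsMaximumMatching.exists_exposes`). So at each
vertex of `D(G) ∪ A(G)` the allowed edges are exactly the edges of the reduced graph, and
reachability from there agrees in both graphs. Such a component always meets `D(G)`, since a vertex
of `A(G)` has a neighbor in `D(G)`. -/

lemma IsMatching.finite (hM : G.IsMatching M) (hfin : V(G).Finite) : M.Finite := by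
  have hend : ∀ e : M, ∃ x, G.Inc e x := fun e ↦ by
    obtain ⟨x, y, h⟩ := G.exists_isLink_of_mem_edgeSet (hM.1 e.2)
    exact ⟨x, h.inc_left⟩
  choose φ hφ using hend
  have : Finite V(G) := hfin
  refine Finite.of_injective (fun e : M ↦ (⟨φ e, (hφ e).vertex_mem⟩ : V(G))) fun a b hab ↦ ?_
  have hab' : φ a = φ b := congrArg Subtype.val hab
  exact Subtype.ext (hM.2 a a.2 b b.2 _ (hφ a) (hab' ▸ hφ b))

lemma IsMaximumMatching.exists_inc (hM : G.IsMaximumMatching M) (hfin : V(G).Finite)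
    (hu : G.Exposes M u) (hf : G.IsLink f u v) : ∃ g ∈ M, G.Inc g v := by
  by_contra! hv
  have hfM : f ∉ M := fun h ↦ hu.2 f h hf.inc_left
  have hend : ∀ h ∈ M, ∀ x, G.Inc h x → ¬ G.Inc f x := by
    intro h hh x hx hfx
    rcases hfx.eq_or_eq_of_isLink hf with rfl | rfl
    exacts [hu.2 h hh hx, hv h hh hx]
  have hmatch : G.IsMatching (insert f M) := by
    refine ⟨Set.insert_subset hf.edge_mem hM.1.1, ?_⟩
    rintro a (rfl | ha) b (rfl | hb) x hax hbx
    · rfl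
    · exact (hend b hb x hbx hax).elim
    · exact (hend a ha x hax hbx).elim
    · exact hM.1.2 a ha b hb x hax hbx
  have hle := hM.2 _ hmatch
  rw [Set.encard_insert_of_notMem hfM] at hle
  -- Finiteness of `M` is what makes adding one edge strictly raise `encard`.
  exact (ENat.lt_add_one_iff (hM.1.finite hfin).encard_lt_top.ne).2 le_rfl |>.not_ge hle

/-- Exchange of a matching edge `g` at `v` for an edge `f` from an exposed vertex to `v`. -/
lemma IsMaximumMatching.exchange (hM : G.IsMaximumMatching M) (hu : G.Exposes M u)
    (hf : G.IsLink f u v) (hg : g ∈ M) (hgv : G.Inc g v) :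
    G.IsMaximumMatching (insert f (M \ {g})) := by
  have hfM : f ∉ M := fun h ↦ hu.2 f h hf.inc_left
  have hend : ∀ h ∈ M \ {g}, ∀ x, G.Inc h x → ¬ G.Inc f x := by
    rintro h ⟨hh, hne⟩ x hx hfx
    rcases hfx.eq_or_eq_of_isLink hf with rfl | rfl
    exacts [hu.2 h hh hx, hne (hM.1.2 h hh g hg _ hx hgv)]
  refine ⟨⟨Set.insert_subset hf.edge_mem (Set.sdiff_subset.trans hM.1.1), ?_⟩, fun N hN ↦ ?_⟩
  · rintro a (rfl | ha) b (rfl | hb) x hax hbx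
    · rfl
    · exact (hend b hb x hbx hax).elim
    · exact (hend a ha x hax hbx).elim
    · exact hM.1.2 a ha.1 b hb.1 x hax hbx
  · rw [Set.encard_exchange hfM hg]
    exact hM.2 N hN

lemma IsMatching.exposes_exchange [G.Loopless] (hM : G.IsMatching M) (hu : G.Exposes M u)
    (hf : G.IsLink f u v) (hg : g ∈ M) (hgv : G.IsLink g v w) :
    G.Exposes (insert f (M \ {g})) w := by
  refine ⟨hgv.right_mem, ?_⟩
  rintro h (rfl | ⟨hh, hne⟩) hw
  · rcases hw.eq_or_eq_of_isLink hf with rfl | rfl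
    exacts [hu.2 g hg hgv.inc_right, hgv.ne rfl]
  · exact hne (hM.2 h hh g hg w hw hgv.inc_right)

/-! ### Edges at `D(G)` and `A(G)` -/

lemma gallaiD_subset (G : Graph α β) : G.gallaiD ⊆ V(G) := fun _ ⟨_, _, hv⟩ ↦ hv.1

lemma gallaiA_subset (G : Graph α β) : G.gallaiA ⊆ V(G) := fun _ hv ↦ hv.1

lemma mem_allowedEdges_of_mem_gallaiD (hfin : V(G).Finite) (hu : u ∈ G.gallaiD)
    (hf : G.IsLink f u v) : f ∈ G.allowedEdges := by
  obtain ⟨M, hM, hMu⟩ := hu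
  obtain ⟨g, hg, hgv⟩ := hM.exists_inc hfin hMu hf
  exact ⟨_, hM.exchange hMu hf hg hgv, Set.mem_insert _ _⟩

/-- A maximum matching can be altered to expose any `d ∈ D(G)` while keeping all of its edges that
have no end in `D(G)`. -/
lemma IsMaximumMatching.exists_exposes [G.Loopless] (hfin : V(G).Finite)
    (hM : G.IsMaximumMatching M) (hN : G.IsMaximumMatching N) {d : α} (hd : G.Exposes N d) :
    ∃ L, G.IsMaximumMatching L ∧ G.Exposes L d ∧ M ∩ N ⊆ L ∧
      ∀ e ∈ M, (∀ x ∈ G.gallaiD, ¬ G.Inc e x) → e ∈ L := by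
  -- Follow the alternating path from `d`: an `M`-edge `f = dv`, then an `N`-edge `g = vw`.
  -- Replacing `g` by `f` moves `N` closer to `M` and exposes `w`.
  induction hn : (N \ M).ncard using Nat.strong_induction_on generalizing N d with
  | _ n ih =>
  by_cases hMd : G.Exposes M d
  · exact ⟨M, hM, hMd, Set.inter_subset_left, fun e he _ ↦ he⟩
  obtain ⟨f, hfM, v, hf⟩ : ∃ f ∈ M, G.Inc f d := by
    by_contra! h
    exact hMd ⟨hd.1, h⟩
  obtain ⟨g, hgN, w, hg⟩ := hN.exists_inc hfin hd hf
  have hfN : f ∉ N := fun h ↦ hd.2 f h hf.inc_left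
  have hgM : g ∉ M := fun h ↦
    hfN (hM.1.2 f hfM g h v hf.inc_right hg.inc_left ▸ hgN)
  have hlt : (insert f (N \ {g}) \ M).ncard < n := by
    rw [← hn]
    refine Set.ncard_lt_ncard ⟨?_, fun h ↦ ?_⟩ ((hN.1.finite hfin).subset Set.sdiff_subset)
    · rintro e ⟨rfl | he, heM⟩
      exacts [(heM hfM).elim, ⟨he.1, heM⟩]
    · rcases (h ⟨hgN, hgM⟩).1 with rfl | h'
      exacts [hfN hgN, h'.2 rfl]
  obtain ⟨L, hL, hLw, hsub, hkeep⟩ := ih _ hlt (hN.exchange hd hf hgN hg.inc_left)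
    (hN.1.exposes_exchange hd hf hgN hg) rfl
  -- The clause `M ∩ N ⊆ L` serves to keep `f` in `L`, so that exchanging it back for `g` moves the
  -- exposed vertex from `w` to `d`.
  have hfL : f ∈ L := hsub ⟨hfM, Set.mem_insert _ _⟩
  refine ⟨insert g (L \ {f}), hL.exchange hLw hg.symm hfL hf.inc_right,
    hL.1.exposes_exchange hLw hg.symm hfL hf.symm, ?_, fun e he hD ↦ ?_⟩
  · rintro e ⟨heM, heN⟩
    have hef : e ≠ f := by rintro rfl; exact hfN heN
    have heg : e ≠ g := by rintro rfl; exact hgM heM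
    exact Or.inr ⟨hsub ⟨heM, Or.inr ⟨heN, heg⟩⟩, hef⟩
  -- The only edge lost is `f`, which has the end `d` in `D(G)`.
  · refine Or.inr ⟨hkeep e he hD, ?_⟩
    rintro rfl
    exact hD d ⟨N, hN, hd⟩ hf.inc_left

/-- If `v` were outside `D(G)`, then `e` would have no end there and would survive in a maximum
matching exposing a neighbor `d` of `u`. Exchanging `e` for the edge `du` then exposes `v`. -/
lemma mem_gallaiD_of_mem_gallaiA [G.Loopless] (hfin : V(G).Finite) (hu : u ∈ G.gallaiA)
    (he : e ∈ G.allowedEdges) (huv : G.IsLink e u v) : v ∈ G.gallaiD := by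
  by_contra hv
  obtain ⟨-, huD, d, ⟨N, hN, hd⟩, f, hf⟩ := hu
  obtain ⟨M, hM, heM⟩ := he
  obtain ⟨L, hL, hLd, -, hkeep⟩ := hM.exists_exposes hfin hN hd
  have heL : e ∈ L := by
    refine hkeep e heM fun x hx hex ↦ ?_
    rcases hex.eq_or_eq_of_isLink huv with rfl | rfl
    exacts [huD hx, hv hx]
  exact hv ⟨_, hL.exchange hLd hf heL huv.inc_left, hL.1.exposes_exchange hLd hf heL huv⟩

/-! ### Connected components -/

lemma subset_reachable_of_isConnected (hK : K ≤ G) (hconn : K.IsConnected) (hx : x ∈ V(K)) :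
    V(K) ⊆ {y | Relation.ReflTransGen G.Adj x y} :=
  fun y hy ↦ (hconn.2 x hx y hy).lift id fun _ _ h ↦ h.mono hK

lemma reachable_subset (hx : x ∈ V(G)) : {y | Relation.ReflTransGen G.Adj x y} ⊆ V(G) := by
  intro y hy
  rcases Relation.ReflTransGen.cases_tail hy with rfl | ⟨z, -, hz⟩
  exacts [hx, hz.right_mem]

lemma reachable_symm (h : Relation.ReflTransGen G.Adj x y) : Relation.ReflTransGen G.Adj y x :=
  have : Std.Symm G.Adj := ⟨fun _ _ h ↦ h.symm⟩
  Std.Symm.symm _ _ h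

lemma isConnected_induce_reachable :
    (G.induce {y | Relation.ReflTransGen G.Adj x y}).IsConnected := by
  have key : ∀ y, Relation.ReflTransGen G.Adj x y →
      Relation.ReflTransGen (G.induce {y | Relation.ReflTransGen G.Adj x y}).Adj x y := by
    intro y hy
    induction hy with
    | refl => exact .refl
    | @tail b c hb hbc ih =>
      obtain ⟨e, he⟩ := hbc
      exact ih.tail ⟨e, he, hb, hb.tail ⟨e, he⟩⟩
  exact ⟨⟨x, .refl⟩, fun y hy z hz ↦ (reachable_symm (key y hy)).trans (key z hz)⟩

lemma le_induce_of_subset {X : Set α} (hK : K ≤ G) (hX : V(K) ⊆ X) : K ≤ G.induce X :=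
  ⟨hX, fun _ _ _ h ↦ ⟨h.mono hK, hX h.left_mem, hX h.right_mem⟩⟩

lemma isConnectedComponent_induce_reachable (hx : x ∈ V(G)) :
    (G.induce {y | Relation.ReflTransGen G.Adj x y}).IsConnectedComponent G :=
  ⟨⟨induce_le (reachable_subset hx), isConnected_induce_reachable⟩, fun _ hL hle ↦
    le_induce_of_subset hL.1 (subset_reachable_of_isConnected hL.1 hL.2
      (hle.vertexSet_mono Relation.ReflTransGen.refl))⟩

lemma IsConnectedComponent.vertexSet_eq (hK : K.IsConnectedComponent G) (hx : x ∈ V(K)) :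
    V(K) = {y | Relation.ReflTransGen G.Adj x y} := by
  have hsub := subset_reachable_of_isConnected hK.prop.1 hK.prop.2 hx
  have hxG : x ∈ V(G) := hK.prop.1.vertexSet_mono hx
  exact hsub.antisymm (hK.le_of_ge (isConnectedComponent_induce_reachable hxG).prop
    (le_induce_of_subset hK.prop.1 hsub)).vertexSet_mono

/-! ### Allowed edges on `D(G) ∪ A(G)` -/

lemma adj_deleteEdges_induce_gallai_iff [G.Loopless] (hfin : V(G).Finite)
    (hx : x ∈ G.gallaiD ∪ G.gallaiA) :
    ((G.induce (G.gallaiD ∪ G.gallaiA)).deleteEdges E(G.induce G.gallaiA)).Adj x y ↔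
      (G.restrict G.allowedEdges).Adj x y := by
  constructor
  · rintro ⟨e, ⟨he, hx', hy'⟩, hA⟩
    refine ⟨e, ?_, he⟩
    rcases hx' with hxD | hxA
    · exact mem_allowedEdges_of_mem_gallaiD hfin hxD he
    rcases hy' with hyD | hyA
    · exact mem_allowedEdges_of_mem_gallaiD hfin hyD he.symm
    · exact (hA ⟨x, y, he, hxA, hyA⟩).elim
  · rintro ⟨e, heA, he⟩
    have hnot : ∀ {z}, G.Inc e z → z ∈ G.gallaiD → e ∉ E(G.induce G.gallaiA) := by
      rintro z hz hzD ⟨a, b, hab, ha, hb⟩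
      rcases hz.eq_or_eq_of_isLink hab with rfl | rfl
      exacts [ha.2.1 hzD, hb.2.1 hzD]
    rcases hx with hxD | hxA
    · refine ⟨e, ⟨he, Or.inl hxD, ?_⟩, hnot he.inc_left hxD⟩
      by_cases hyD : y ∈ G.gallaiD
      exacts [Or.inl hyD, Or.inr ⟨he.right_mem, hyD, x, hxD, e, he⟩]
    · have hyD := mem_gallaiD_of_mem_gallaiA hfin hxA heA he
      exact ⟨e, ⟨he, Or.inr hxA, Or.inl hyD⟩, hnot he.inc_right hyD⟩

lemma reachable_gallai_iff [G.Loopless] (hfin : V(G).Finite) (hx : x ∈ G.gallaiD ∪ G.gallaiA) :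
    Relation.ReflTransGen
        ((G.induce (G.gallaiD ∪ G.gallaiA)).deleteEdges E(G.induce G.gallaiA)).Adj x y ↔
      Relation.ReflTransGen (G.restrict G.allowedEdges).Adj x y := by
  constructor <;> intro h
  · induction h with
    | refl => exact .refl
    | tail _ hbc ih =>
      exact ih.tail ((adj_deleteEdges_induce_gallai_iff hfin hbc.left_mem).1 hbc)
  · induction h with
    | refl => exact .refl
    | tail _ hbc ih =>
      -- The path reached so far lies in the reduced graph, so its last vertex is still in `D(G) ∪
      -- A(G)`.
      exact ih.tail ((adj_deleteEdges_induce_gallai_iff hfin (reachable_subset hx ih)).2 hbc)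

end Graph

open Graph in
theorem mainTheorem5 {α β : Type*} (G : Graph α β) [G.Loopless] (hfin : V(G).Finite)
    (H : Graph α β) (hH : H ≤ G) :
    H.IsInconsistentFactorComponent G ↔
      ∃ K : Graph α β,
        K.IsConnectedComponent
          ((G.induce (G.gallaiD ∪ G.gallaiA)).deleteEdges E(G.induce G.gallaiA)) ∧
        H = G.induce V(K) := by
  constructor
  · rintro ⟨⟨C, hC, rfl⟩, hincon⟩
    have hnd : ¬ Disjoint V(C) G.gallaiD := fun h ↦ hincon ⟨⟨C, hC, rfl⟩, h⟩
    obtain ⟨x, hxC, hxD⟩ := Set.not_disjoint_iff.1 hnd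
    have hx : x ∈ G.gallaiD ∪ G.gallaiA := Or.inl hxD
    refine ⟨_, isConnectedComponent_induce_reachable (x := x) hx, congrArg G.induce ?_⟩
    rw [hC.vertexSet_eq hxC]
    exact Set.ext fun y ↦ (reachable_gallai_iff hfin hx).symm
  · rintro ⟨K, hK, rfl⟩
    obtain ⟨x, hxK⟩ := hK.prop.2.1
    have hx : x ∈ G.gallaiD ∪ G.gallaiA := hK.prop.1.vertexSet_mono hxK
    have hxG : x ∈ V(G.restrict G.allowedEdges) :=
      Set.union_subset G.gallaiD_subset G.gallaiA_subset hx
    refine ⟨⟨_, isConnectedComponent_induce_reachable hxG, congrArg G.induce ?_⟩,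
      fun h ↦ ?_⟩
    · rw [hK.vertexSet_eq hxK]
      exact Set.ext fun y ↦ reachable_gallai_iff hfin hx
    · have hdisj : Disjoint V(K) G.gallaiD := h.2
      rw [hK.vertexSet_eq hxK] at hdisj
      rcases hx with hxD | hxA
      · exact Set.disjoint_left.1 hdisj .refl hxD
      -- A neighbor of `x` in `D(G)` lies in the same component.
      · obtain ⟨-, -, d, hd, e, he⟩ := id hxA
        refine Set.disjoint_left.1 hdisj ((reachable_gallai_iff hfin (Or.inr hxA)).2 ?_) hd
        exact .single ⟨e, mem_allowedEdges_of_mem_gallaiD hfin hd he, he.symm⟩
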